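/- Let $K$ be a field and let $a,b,c,\alpha,\beta,\gamma$ be integers with $0\le\alpha<a$, $0\le\beta<b$, $0\le\gamma<c$, at most one of $\alpha,\beta,\gamma$ being zero, and $a+b+c+\alpha+\beta+\gamma\equiv 0 \pmod 3$. Put $R=K[x,y,z]$, $I=(x^a,y^b,z^c,x^\alpha y^\beta z^\gamma)$, $$s=\tfrac13(a+b+c+\alpha+\beta+\gamma)-2,\quad A=s+2-a,\quad B=s+2-b,\quad C=s+2-c,\quad M=s+2-(\alpha+\beta+\gamma),$$ and assume that $M\ge 0$, $0\le A\le\beta+\gamma$, $0\le B\le\alpha+\gamma$ and $0\le C\le\alpha+\beta$. (Under these conditions the monomials of degrees $s$ and $s+1$ not in $I$, drawn in the triangular lattice, form the punctured hexagon $H_{a,b,c,\alpha,\beta,\gamma}$ with side lengths $A,B+M,C,A+M,B,C+M$ and a triangular puncture of side $M$.) Let $m_1,\dots,m_{h_s}$ and $n_1,\dots,n_{h_{s+1}}$ be the monomials of degree $s$ and of degree $s+1$, respectively, that do not lie in $I$, each listed in lexicographic order. Let $Z=Z_{a,b,c,\alpha,\beta,\gamma}$ be the integer matrix with $Z_{i,j}=1$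 if $n_j$ is a multiple of $m_i$ and $Z_{i,j}=0$ otherwise. Let $N=N_{a,b,c,\alpha,\beta,\gamma}$ be the integer matrix of size $C+M$ with $$N_{i,j}=\begin{cases}\binom{c}{A+j-i} & \text{if } 1\le i\le C,\\[2pt] \binom{\gamma}{A+C-\beta+j-i} & \text{if } C+1\le i\le C+M,\end{cases}$$ where $\binom{n}{k}=0$ for $k<0$ or $k>n$. Then $h_s=h_{s+1}$, so that $Z$ is square, and $$|\det Z_{a,b,c,\alpha,\beta,\gamma}| = |\det N_{a,b,c,\alpha,\beta,\gamma}|.$$ -/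

import Mathlib

noncomputable section

/-- The monomial ideal `(x^a, y^b, z^c, x^α y^β z^γ)` of `K[x, y, z]`, with `x = X 0`, `y = X 1`,
`z = X 2`. -/
def monomialACI (K : Type*) [Field K] (a b c α β γ : ℕ) : Ideal (MvPolynomial (Fin 3) K) :=
  Ideal.span {MvPolynomial.X 0 ^ a, MvPolynomial.X 1 ^ b, MvPolynomial.X 2 ^ c,
    MvPolynomial.X 0 ^ α * MvPolynomial.X 1 ^ β * MvPolynomial.X 2 ^ γ}

open Classical in
/-- The monomial basis of the degree `d` component of `K[x, y, z] / I`, for a monomial ideal `I`: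
the (exponent vectors of) monomials of degree `d` that do not lie in `I`. The type synonym `Lex`
orders them lexicographically, the exponent of `x` being compared first. -/
def monomialBasis {K : Type*} [Field K] (I : Ideal (MvPolynomial (Fin 3) K)) (d : ℕ) :
    Finset (Lex (Fin 3 →₀ ℕ)) :=
  (((Finset.univ : Finset (Fin 3)).finsuppAntidiag d).filter
    (fun m => MvPolynomial.monomial m (1 : K) ∉ I)).map toLex.toEmbedding

/-- `h_d`, the number of elements of the monomial basis of `[K[x, y, z] / I]_d`. -/
def hVec {K : Type*} [Field K] (I : Ideal (MvPolynomial (Fin 3) K)) (d : ℕ) : ℕ :=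
  (monomialBasis I d).card

/-- The `i`-th element (counted from `0`) of the monomial basis of `[K[x, y, z] / I]_d`, listed in
lexicographic order, as an exponent vector. -/
def basisMonomial {K : Type*} [Field K] (I : Ideal (MvPolynomial (Fin 3) K)) (d : ℕ)
    (i : Fin (hVec I d)) : Fin 3 →₀ ℕ :=
  ofLex ((monomialBasis I d).orderEmbOfFin rfl i)

/-- The zero-one matrix `Z` of `I` between degrees `s` and `s + 1`: rows are indexed by the basis
monomials of degree `s`, columns by those of degree `s + 1`, and the entry is `1` exactly when the
column monomial is a multiple of the row monomial. -/
def matrixZ {K : Type*} [Field K] (I : Ideal (MvPolynomial (Fin 3) K)) (s : ℕ) :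
    Matrix (Fin (hVec I s)) (Fin (hVec I (s + 1))) ℤ :=
  Matrix.of fun i j => if basisMonomial I s i ≤ basisMonomial I (s + 1) j then 1 else 0

/-- The binomial coefficient `n` over `k` with an integer lower index; it is `0` for `k < 0`. -/
def binom (n : ℕ) (k : ℤ) : ℤ :=
  if 0 ≤ k then (n.choose k.toNat : ℤ) else 0

/-- The binomial matrix `N`, of size `C + M`. Rows and columns are counted from `0`, so the first
`C` rows are those with `i < C`; the difference `j - i` does not depend on where counting starts. -/
def matrixN (c β γ A C M : ℕ) : Matrix (Fin (C + M)) (Fin (C + M)) ℤ :=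
  Matrix.of fun i j =>
    if (i : ℕ) < C then binom c ((A : ℤ) + (j : ℤ) - (i : ℤ))
    else binom γ ((A : ℤ) + (C : ℤ) - (β : ℤ) + (j : ℤ) - (i : ℤ))

end

/-!
Let `S = ℤ[x, y, z]`, let `I` be the monomial ideal over `ℤ`, and let `ℓ = x + y + z`. In the
monomial bases, `Z` describes multiplication by `ℓ` from degree `s` to degree `s + 1` of `S / I`, so
its cokernel is the degree `s + 1` component of `S / (I, ℓ)`. Eliminating `z = -(x + y)` turns this
into the degree `s + 1` component of `ℤ[x, y] / (x^a, y^b, (x + y)^c, x^α y^β (x + y)^γ)`. The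
monomials of degree `s + 1` that survive the first two relations are the `C + M` monomials
`x^(s+1-e) y^e` with `A ≤ e < b`, and the other two contribute the `C` relations
`x^(C-1-i) y^i (x + y)^c` and the `M` relations `x^(α+M-1-i) y^(β+i) (x + y)^γ`. Their coefficients
are the rows of `N`, so `N` has the same cokernel as `Z`. As the absolute value of the determinant
of a square integer matrix is the order of its cokernel, read as `0` if infinite
(`Matrix.natCard_quotient_span_row`), the two determinants agree up to sign.

The comparison of cokernels avoids quotient rings. Both `ℤ^(h_(s+1))` and `ℤ^(C+M)` receive a
surjection from `S`, namely `coeffMap`, taking coefficients at the basis monomials, and `windowMap`,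
taking the coefficients above after substituting `-(x + y)` for `z`. The row lattices of `Z` and
`N` have the same preimage in `S` (`abs_det_divisibility_eq_abs_det_matrixN`), whence
`Matrix.abs_det_eq_of_comap_span_row_eq` applies.

That `Z` is square is a count of monomials: the bounds on `A`, `B` and `C`, together with
`a + b - (s + 2) = C + M ≥ 0` and its two analogues, say that no monomial of degree at most `s + 1`
is divisible by two of the four generators, so that `h_d` is an alternating
sum of binomial coefficients (`hVec_add`).
-/

/-! ### Determinants of integer matrices as orders of cokernels -/

/-- The order of the cokernel of a square integer matrix is the absolute value of its determinant;
both are `0` when the cokernel is infinite. -/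
theorem Matrix.natCard_quotient_span_row {n : Type*} [Fintype n] [DecidableEq n]
    (X : Matrix n n ℤ) :
    Nat.card ((n → ℤ) ⧸ Submodule.span ℤ (Set.range X.row)) = X.det.natAbs := by
  rw [← _root_.range_vecMulLinear]
  by_cases hdet : X.det = 0
  · rw [hdet, Int.natAbs_zero]
    by_contra hcard
    set k := Nat.card ((n → ℤ) ⧸ LinearMap.range X.vecMulLinear) with hk
    -- A finite cokernel is annihilated by its order `k`, so `k • 1 = W * X` for some `W`.
    have hmem : ∀ v : n → ℤ, ∃ w, X.vecMulLinear w = k • v := by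
      intro v
      have h0 : k • (Submodule.Quotient.mk v : (n → ℤ) ⧸ LinearMap.range X.vecMulLinear) = 0 :=
        card_nsmul_eq_zero'
      rw [← Submodule.Quotient.mk_smul, Submodule.Quotient.mk_eq_zero] at h0
      exact h0
    choose w hw using fun i : n => hmem (Pi.single i 1)
    have hprod : Matrix.of w * X = (k : ℤ) • (1 : Matrix n n ℤ) := by
      ext i j
      have h := congrFun (hw i) j
      simp only [Matrix.vecMulLinear_apply] at h
      rw [Matrix.mul_apply_eq_vecMul]
      change (Matrix.vecMul (w i) X) j = _
      rw [h]
      simp [Matrix.one_apply, Pi.single_apply, eq_comm]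
    have h := congrArg Matrix.det hprod
    rw [Matrix.det_mul, hdet, mul_zero, Matrix.det_smul, Matrix.det_one, mul_one] at h
    exact hcard (by exact_mod_cast eq_zero_of_pow_eq_zero h.symm)
  · have hinj : Function.Injective X.vecMulLinear := by
      rw [← LinearMap.ker_eq_bot, LinearMap.ker_eq_bot']
      exact fun v hv => Matrix.eq_zero_of_vecMul_eq_zero hdet hv
    rw [← Submodule.natAbs_det_equiv _ (LinearEquiv.ofInjective _ hinj), ← Matrix.det_transpose,
      ← LinearMap.det_toLin']
    congr 2
    ext v j
    simp

theorem Submodule.natCard_quotient_comap {E F : Type*} [AddCommGroup E] [AddCommGroup F]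
    {f : E →ₗ[ℤ] F} (hf : Function.Surjective f) (L : Submodule ℤ F) :
    Nat.card (E ⧸ L.comap f) = Nat.card (F ⧸ L) :=
  AddSubgroup.index_comap_of_surjective (f := f.toAddMonoidHom) L.toAddSubgroup hf

/-- Two square integer matrices, possibly of different sizes, have the same determinant up to sign
if their row lattices have the same preimage under surjections from a common group: their cokernels
are then isomorphic. -/
theorem Matrix.abs_det_eq_of_comap_span_row_eq {E m n : Type*} [AddCommGroup E]
    [Fintype m] [DecidableEq m] [Fintype n] [DecidableEq n]
    {p : E →ₗ[ℤ] (m → ℤ)} {q : E →ₗ[ℤ] (n → ℤ)}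
    (hp : Function.Surjective p) (hq : Function.Surjective q)
    {X : Matrix m m ℤ} {Y : Matrix n n ℤ}
    (h : (Submodule.span ℤ (Set.range X.row)).comap p =
      (Submodule.span ℤ (Set.range Y.row)).comap q) :
    |X.det| = |Y.det| := by
  have hX := Submodule.natCard_quotient_comap hp (Submodule.span ℤ (Set.range X.row))
  have hY := Submodule.natCard_quotient_comap hq (Submodule.span ℤ (Set.range Y.row))
  rw [Matrix.natCard_quotient_span_row] at hX hY
  rw [h, hY] at hX
  rw [Int.abs_eq_natAbs, Int.abs_eq_natAbs, hX]

/-! ### Exponent vectors and the monomial ideal -/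

/-- The exponent vector `m` dominates that of one of the generators `x^a`, `y^b`, `z^c`,
`x^α y^β z^γ`; equivalently, the monomial with exponent vector `m` lies in the ideal they
generate. -/
def DominatesGenerator (a b c α β γ : ℕ) (m : Fin 3 →₀ ℕ) : Prop :=
  a ≤ m 0 ∨ b ≤ m 1 ∨ c ≤ m 2 ∨ (α ≤ m 0 ∧ β ≤ m 1 ∧ γ ≤ m 2)

/-- The exponent vector of `x^i y^j z^k`. -/
noncomputable def expVec (i j k : ℕ) : Fin 3 →₀ ℕ :=
  Finsupp.equivFunOnFinite.symm ![i, j, k]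

@[simp] theorem expVec_zero (i j k : ℕ) : expVec i j k 0 = i := rfl
@[simp] theorem expVec_one (i j k : ℕ) : expVec i j k 1 = j := rfl
@[simp] theorem expVec_two (i j k : ℕ) : expVec i j k 2 = k := rfl

theorem exponent_ext {m n : Fin 3 →₀ ℕ} (h0 : m 0 = n 0) (h1 : m 1 = n 1) (h2 : m 2 = n 2) :
    m = n := by
  ext i
  fin_cases i <;> assumption

theorem exponent_le_iff {m n : Fin 3 →₀ ℕ} : m ≤ n ↔ m 0 ≤ n 0 ∧ m 1 ≤ n 1 ∧ m 2 ≤ n 2 := by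
  refine ⟨fun h => ⟨h 0, h 1, h 2⟩, fun ⟨h0, h1, h2⟩ i => ?_⟩
  fin_cases i <;> assumption

theorem monomial_expVec {R : Type*} [CommRing R] (i j k : ℕ) :
    (MvPolynomial.monomial (expVec i j k) (1 : R)) =
      MvPolynomial.X 0 ^ i * MvPolynomial.X 1 ^ j * MvPolynomial.X 2 ^ k := by
  rw [MvPolynomial.monomial_eq, Finsupp.prod_fintype _ _ (by simp), Fin.prod_univ_three]
  simp

theorem monomial_mem_monomialACI_iff {K : Type*} [Field K] {a b c α β γ : ℕ} {m : Fin 3 →₀ ℕ} :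
    MvPolynomial.monomial m (1 : K) ∈ monomialACI K a b c α β γ ↔
      DominatesGenerator a b c α β γ m := by
  have hI : monomialACI K a b c α β γ = Ideal.span ((fun n => MvPolynomial.monomial n (1 : K)) ''
      {expVec a 0 0, expVec 0 b 0, expVec 0 0 c, expVec α β γ}) := by
    simp [monomialACI, Set.image_insert_eq, monomial_expVec]
  classical
  rw [hI, MvPolynomial.mem_ideal_span_monomial_image]
  simp [MvPolynomial.support_monomial, exponent_le_iff, DominatesGenerator]

theorem DominatesGenerator.mono {a b c α β γ : ℕ} {m n : Fin 3 →₀ ℕ} (hmn : m ≤ n)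
    (h : DominatesGenerator a b c α β γ m) : DominatesGenerator a b c α β γ n := by
  rw [exponent_le_iff] at hmn
  unfold DominatesGenerator at *
  omega

theorem mem_monomialBasis_iff {K : Type*} [Field K] {a b c α β γ d : ℕ}
    {m : Lex (Fin 3 →₀ ℕ)} :
    m ∈ monomialBasis (monomialACI K a b c α β γ) d ↔
      (ofLex m) 0 + (ofLex m) 1 + (ofLex m) 2 = d ∧
        ¬ DominatesGenerator a b c α β γ (ofLex m) := by
  simp [monomialBasis, monomial_mem_monomialACI_iff, Finset.mem_map_equiv, Fin.sum_univ_three]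

theorem basisMonomial_injective {K : Type*} [Field K] (I : Ideal (MvPolynomial (Fin 3) K))
    (d : ℕ) : Function.Injective (basisMonomial I d) :=
  ofLex.injective.comp ((monomialBasis I d).orderEmbOfFin rfl).injective

theorem mem_range_basisMonomial_iff {K : Type*} [Field K] {a b c α β γ d : ℕ}
    {m : Fin 3 →₀ ℕ} :
    m ∈ Set.range (basisMonomial (monomialACI K a b c α β γ) d) ↔
      m 0 + m 1 + m 2 = d ∧ ¬ DominatesGenerator a b c α β γ m := by
  have h := mem_monomialBasis_iff (K := K) (a := a) (b := b) (c := c) (α := α) (β := β) (γ := γ)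
    (d := d) (m := toLex m)
  rw [ofLex_toLex] at h
  rw [← h, ← Finset.mem_coe, ← Finset.range_orderEmbOfFin _ rfl]
  rfl

/-! ### The number of basis monomials -/

/-- There are `choose n 2` exponent vectors of degree `d` that dominate `(i, j, k)`, where
`n = d + 2 - (i + j + k)`. -/
theorem card_filter_finsuppAntidiag_le {d n i j k : ℕ} (h : n + (i + j + k) = d + 2) :
    (((Finset.univ : Finset (Fin 3)).finsuppAntidiag d).filter
      (fun m => i ≤ m 0 ∧ j ≤ m 1 ∧ k ≤ m 2)).card = n.choose 2 := by
  rcases Nat.lt_or_ge n 2 with hn | hn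
  · rw [Nat.choose_eq_zero_of_lt hn, Finset.card_eq_zero, Finset.filter_eq_empty_iff]
    intro m hm
    simp [Fin.sum_univ_three] at hm
    omega
  · obtain ⟨e, rfl⟩ := Nat.exists_eq_add_of_le hn
    have hcard : ((Finset.univ : Finset (Fin 3)).finsuppAntidiag e).card = (2 + e).choose 2 := by
      rw [Finset.card_finsuppAntidiag_nat_eq_choose, Finset.card_univ, Fintype.card_fin,
        show 3 + e - 1 = 2 + e by omega, Nat.choose_symm_add]
    rw [← hcard]
    symm
    refine Finset.card_bij (fun m _ => m + expVec i j k) ?_ ?_ ?_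
    · intro m hm
      simp [Fin.sum_univ_three] at hm ⊢
      omega
    · intro m _ m' _ hmm
      exact add_right_cancel hmm
    · intro m hm
      simp [Fin.sum_univ_three] at hm
      refine ⟨m - expVec i j k, ?_, ?_⟩
      · simp [Fin.sum_univ_three]
        omega
      · apply exponent_ext <;> simp <;> omega

/-- Inclusion and exclusion for `h_d`, in degrees so small that no monomial is divisible by two of
the generators. -/
theorem hVec_add {K : Type*} [Field K] {a b c α β γ d n na nb nc nm : ℕ}
    (hn : n = d + 2) (ha : na + a = d + 2) (hb : nb + b = d + 2) (hc : nc + c = d + 2)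
    (hm : nm + (α + β + γ) = d + 2)
    (hab : d < a + b) (hac : d < a + c) (hbc : d < b + c)
    (hA : d < a + β + γ) (hB : d < α + b + γ) (hC : d < α + β + c) :
    hVec (monomialACI K a b c α β γ) d +
      (na.choose 2 + nb.choose 2 + nc.choose 2 + nm.choose 2) = n.choose 2 := by
  classical
  have e1 := card_filter_finsuppAntidiag_le (d := d) (n := na) (i := a) (j := 0) (k := 0) ha
  have e2 := card_filter_finsuppAntidiag_le (d := d) (n := nb) (i := 0) (j := b) (k := 0)
    (by omega)
  have e3 := card_filter_finsuppAntidiag_le (d := d) (n := nc) (i := 0) (j := 0) (k := c)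
    (by omega)
  have e4 := card_filter_finsuppAntidiag_le hm
  have e0 := card_filter_finsuppAntidiag_le (d := d) (n := n) (i := 0) (j := 0) (k := 0)
    (by omega)
  have ev : hVec (monomialACI K a b c α β γ) d =
      (((Finset.univ : Finset (Fin 3)).finsuppAntidiag d).filter
        (fun m => ¬ DominatesGenerator a b c α β γ m)).card := by
    rw [hVec, monomialBasis, Finset.card_map]
    congr 1
    ext m
    simp [monomial_mem_monomialACI_iff]
  rw [ev, ← e0, ← e1, ← e2, ← e3, ← e4]
  simp only [Finset.card_filter, ← Finset.sum_add_distrib]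
  refine Finset.sum_congr rfl fun m hm => ?_
  simp only [Finset.mem_finsuppAntidiag, Fin.sum_univ_three] at hm
  unfold DominatesGenerator
  -- No exponent vector of degree `d` dominates two of the generators.
  split_ifs <;> omega

/-- By `hVec_add` the difference of the two sides is `(s + 2) - A - B - C - M = 0`. -/
theorem hVec_eq_hVec_succ {K : Type*} [Field K] {a b c α β γ s A B C M : ℕ}
    (hs : a + b + c + α + β + γ = 3 * (s + 2))
    (hA : A + a = s + 2) (hB : B + b = s + 2) (hC : C + c = s + 2)
    (hM : M + (α + β + γ) = s + 2)
    (hA' : A ≤ β + γ) (hB' : B ≤ α + γ) (hC' : C ≤ α + β) :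
    hVec (monomialACI K a b c α β γ) s = hVec (monomialACI K a b c α β γ) (s + 1) := by
  have h := hVec_add (K := K) (d := s) (n := s + 2) (na := A) (nb := B) (nc := C) (nm := M)
    (a := a) (b := b) (c := c) (α := α) (β := β) (γ := γ) rfl hA hB hC hM
    (by omega) (by omega) (by omega) (by omega) (by omega) (by omega)
  have h' := hVec_add (K := K) (d := s + 1) (n := s + 3) (na := A + 1) (nb := B + 1)
    (nc := C + 1) (nm := M + 1) (a := a) (b := b) (c := c) (α := α) (β := β) (γ := γ) rfl
    (by omega) (by omega) (by omega) (by omega)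
    (by omega) (by omega) (by omega) (by omega) (by omega) (by omega)
  have step : ∀ n : ℕ, (n + 1).choose 2 = n + n.choose 2 := fun n => by
    rw [Nat.choose_succ_succ' n 1, Nat.choose_one_right]
  rw [step A, step B, step C, step M, step (s + 2)] at h'
  omega

/-! ### Elimination of `z` modulo `x + y + z` -/

open MvPolynomial in
/-- The substitution `z ↦ -(x + y)` in `ℤ[x, y, z]`. -/
noncomputable def elimZ : MvPolynomial (Fin 3) ℤ →ₐ[ℤ] MvPolynomial (Fin 3) ℤ :=
  aeval ![X 0, X 1, -(X 0 + X 1)]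

/-- The linear form `x + y + z`. -/
noncomputable def linForm : MvPolynomial (Fin 3) ℤ :=
  MvPolynomial.X 0 + MvPolynomial.X 1 + MvPolynomial.X 2

/-- The coefficients of a polynomial at a family of exponent vectors. -/
noncomputable def coeffMap {ι : Type*} (f : ι → Fin 3 →₀ ℕ) :
    MvPolynomial (Fin 3) ℤ →ₗ[ℤ] (ι → ℤ) :=
  LinearMap.pi fun i => MvPolynomial.lcoeff ℤ (f i)

theorem coeffMap_apply {ι : Type*} (f : ι → Fin 3 →₀ ℕ) (u : MvPolynomial (Fin 3) ℤ) (i : ι) :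
    coeffMap f u i = MvPolynomial.coeff (f i) u := rfl

theorem coeffMap_sum_monomial {ι : Type*} [Fintype ι] {f : ι → Fin 3 →₀ ℕ}
    (hf : Function.Injective f) (v : ι → ℤ) :
    coeffMap f (∑ i, MvPolynomial.monomial (f i) (v i)) = v := by
  classical
  ext j
  simp [coeffMap_apply, MvPolynomial.coeff_sum, MvPolynomial.coeff_monomial, hf.eq_iff]

theorem linForm_eq_sum_monomial :
    linForm = ∑ i : Fin 3, MvPolynomial.monomial (Finsupp.single i 1) (1 : ℤ) := by
  rw [Fin.sum_univ_three]
  rfl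

/-- Multiplication by `x + y + z` is described by divisibility of monomials. -/
theorem coeff_linForm_mul_monomial (m n : Fin 3 →₀ ℕ) (r : ℤ) :
    MvPolynomial.coeff n (linForm * MvPolynomial.monomial m r) =
      if m ≤ n ∧ n 0 + n 1 + n 2 = m 0 + m 1 + m 2 + 1 then r else 0 := by
  classical
  rw [MvPolynomial.coeff_mul_monomial', linForm_eq_sum_monomial, MvPolynomial.coeff_sum,
    Fin.sum_univ_three]
  simp only [MvPolynomial.coeff_monomial]
  by_cases hmn : m ≤ n
  · have hmn' := exponent_le_iff.mp hmn
    have key : ∀ i : Fin 3, Finsupp.single i 1 = n - m ↔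
        (Finsupp.single i 1 : Fin 3 →₀ ℕ) 0 = n 0 - m 0 ∧
        (Finsupp.single i 1 : Fin 3 →₀ ℕ) 1 = n 1 - m 1 ∧
        (Finsupp.single i 1 : Fin 3 →₀ ℕ) 2 = n 2 - m 2 := fun i =>
      ⟨fun h => by rw [h]; simp, fun ⟨h0, h1, h2⟩ => exponent_ext h0 h1 h2⟩
    simp only [key, hmn, true_and, if_true]
    simp
    split_ifs <;> omega
  · simp [hmn]

theorem elimZ_linForm : elimZ linForm = 0 := by
  simp [elimZ, linForm]

theorem elimZ_monomial (m : Fin 3 →₀ ℕ) :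
    elimZ (MvPolynomial.monomial m 1) = (-1) ^ m 2 *
      (MvPolynomial.X 0 ^ m 0 * MvPolynomial.X 1 ^ m 1 *
        (MvPolynomial.X 1 + MvPolynomial.X 0) ^ m 2) := by
  have hm : m = expVec (m 0) (m 1) (m 2) := exponent_ext rfl rfl rfl
  have h : MvPolynomial.monomial m (1 : ℤ) = _ :=
    (congrArg (fun m => MvPolynomial.monomial m (1 : ℤ)) hm).trans (monomial_expVec _ _ _)
  rw [h]
  simp only [elimZ, map_mul, map_pow, MvPolynomial.aeval_X]
  simp only [Matrix.cons_val]
  rw [neg_pow, add_comm (MvPolynomial.X 0)]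
  ring

theorem elimZ_monomial_of_two_eq_zero {m : Fin 3 →₀ ℕ} (h : m 2 = 0) (r : ℤ) :
    elimZ (MvPolynomial.monomial m r) = MvPolynomial.monomial m r := by
  have hm : m = expVec (m 0) (m 1) 0 := exponent_ext rfl rfl h
  have h1 : elimZ (MvPolynomial.monomial m 1) = MvPolynomial.monomial m 1 := by
    rw [elimZ_monomial, h, hm, monomial_expVec]
    simp
  rw [← mul_one r, ← smul_eq_mul, ← MvPolynomial.smul_monomial, map_smul, h1]

theorem elimZ_elimZ (u : MvPolynomial (Fin 3) ℤ) : elimZ (elimZ u) = elimZ u := by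
  have h : elimZ.comp elimZ = elimZ := by
    ext i
    fin_cases i <;> simp [elimZ]
  exact DFunLike.congr_fun h u

theorem eq_zero_of_mem_support_elimZ {u : MvPolynomial (Fin 3) ℤ} {m : Fin 3 →₀ ℕ}
    (hm : m ∈ (elimZ u).support) : m 2 = 0 := by
  have hrange : elimZ u ∈ MvPolynomial.supported ℤ ({0, 1} : Set (Fin 3)) := by
    have h0 : (MvPolynomial.X 0 : MvPolynomial (Fin 3) ℤ) ∈
        MvPolynomial.supported ℤ ({0, 1} : Set (Fin 3)) := by
      rw [MvPolynomial.X_mem_supported]; simp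
    have h1 : (MvPolynomial.X 1 : MvPolynomial (Fin 3) ℤ) ∈
        MvPolynomial.supported ℤ ({0, 1} : Set (Fin 3)) := by
      rw [MvPolynomial.X_mem_supported]; simp
    have hle : (MvPolynomial.aeval ![MvPolynomial.X 0, MvPolynomial.X 1,
        -(MvPolynomial.X 0 + MvPolynomial.X 1)] :
          MvPolynomial (Fin 3) ℤ →ₐ[ℤ] MvPolynomial (Fin 3) ℤ).range ≤
        MvPolynomial.supported ℤ ({0, 1} : Set (Fin 3)) := by
      rw [← Algebra.adjoin_range_eq_range_aeval, Algebra.adjoin_le_iff]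
      rintro _ ⟨i, rfl⟩
      fin_cases i
      · exact h0
      · exact h1
      · exact neg_mem (add_mem h0 h1)
    exact hle ⟨u, rfl⟩
  by_contra h
  have hv : (2 : Fin 3) ∈ (elimZ u).vars :=
    (MvPolynomial.mem_vars_iff_mem_support 2).mpr ⟨m, hm, Finsupp.mem_support_iff.mpr h⟩
  have := MvPolynomial.mem_supported.mp hrange hv
  simp at this

/-- The kernel of `z ↦ -(x + y)` is generated by `x + y + z`. -/
theorem exists_sub_elimZ_eq (u : MvPolynomial (Fin 3) ℤ) : ∃ v, u - elimZ u = linForm * v := by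
  have h : (Ideal.Quotient.mkₐ ℤ (Ideal.span {linForm})).comp elimZ =
      Ideal.Quotient.mkₐ ℤ (Ideal.span {linForm}) := by
    ext i
    fin_cases i
    · simp [elimZ]
    · simp [elimZ]
    · change Ideal.Quotient.mk _ (elimZ (MvPolynomial.X 2)) =
        Ideal.Quotient.mk _ (MvPolynomial.X 2)
      rw [Ideal.Quotient.eq, Ideal.mem_span_singleton]
      refine ⟨-1, ?_⟩
      simp [elimZ, linForm]
      ring
  have hu := DFunLike.congr_fun h u
  exact Ideal.mem_span_singleton.mp (Ideal.Quotient.eq.mp hu.symm)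

/-- The coefficient of `x^p y^e` in `x^i y^j (x + y)^k`. -/
theorem coeff_X_pow_mul_add_pow (i j k p e : ℕ) :
    MvPolynomial.coeff (expVec p e 0) (MvPolynomial.X 0 ^ i * MvPolynomial.X 1 ^ j *
      (MvPolynomial.X 1 + MvPolynomial.X 0) ^ k : MvPolynomial (Fin 3) ℤ) =
      if i + j + k = p + e then binom k ((e : ℤ) - j) else 0 := by
  classical
  have hexp : (MvPolynomial.X 0 ^ i * MvPolynomial.X 1 ^ j *
      (MvPolynomial.X 1 + MvPolynomial.X 0) ^ k : MvPolynomial (Fin 3) ℤ) =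
      ∑ t ∈ Finset.range (k + 1),
        MvPolynomial.monomial (expVec (i + (k - t)) (j + t) 0) (k.choose t : ℤ) := by
    rw [add_pow, Finset.mul_sum]
    refine Finset.sum_congr rfl fun t _ => ?_
    rw [← mul_one (k.choose t : ℤ), ← MvPolynomial.C_mul_monomial, monomial_expVec]
    simp only [map_natCast]
    ring
  have hiff : ∀ t, expVec (i + (k - t)) (j + t) 0 = expVec p e 0 ↔
      i + (k - t) = p ∧ j + t = e := fun t =>
    ⟨fun h => ⟨DFunLike.congr_fun h 0, DFunLike.congr_fun h 1⟩, fun ⟨h, h'⟩ => by rw [h, h']⟩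
  rw [hexp, MvPolynomial.coeff_sum]
  simp only [MvPolynomial.coeff_monomial, hiff]
  unfold binom
  by_cases hje : j ≤ e
  · rw [Finset.sum_eq_single (e - j)]
    · have he : ((e : ℤ) - j).toNat = e - j := by omega
      rw [he, if_pos (show (0 : ℤ) ≤ (e : ℤ) - j by omega)]
      by_cases hk : e - j ≤ k
      · exact if_congr (by omega) rfl rfl
      · rw [Nat.choose_eq_zero_of_lt (by omega)]
        simp
    · intro t _ ht
      exact if_neg (by omega)
    · intro ht
      rw [Finset.mem_range] at ht
      rw [Nat.choose_eq_zero_of_lt (by omega)]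
      simp
  · rw [if_neg (show ¬ (0 : ℤ) ≤ (e : ℤ) - j by omega), ite_self]
    exact Finset.sum_eq_zero fun t _ => if_neg (by omega)

theorem coeff_elimZ_monomial (m : Fin 3 →₀ ℕ) (p e : ℕ) :
    MvPolynomial.coeff (expVec p e 0) (elimZ (MvPolynomial.monomial m 1)) =
      (-1) ^ m 2 * if m 0 + m 1 + m 2 = p + e then binom (m 2) ((e : ℤ) - m 1) else 0 := by
  rw [elimZ_monomial, ← coeff_X_pow_mul_add_pow]
  have h : ((-1) ^ m 2 : MvPolynomial (Fin 3) ℤ) = MvPolynomial.C ((-1) ^ m 2) := by simp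
  rw [h, MvPolynomial.coeff_C_mul]

/-! ### The cokernels of the two matrices -/

/-- The exponent vectors of the monomials `x^(s+1-e) y^e` with `A ≤ e < A + n`. They have degree
`s + 1` when `A + n ≤ s + 2`; otherwise the subtraction truncates. -/
noncomputable def windowVec (s A n : ℕ) (j : Fin n) : Fin 3 →₀ ℕ :=
  expVec (s + 1 - (A + j)) (A + j) 0

/-- The coefficients, at the monomials `windowVec s A n`, of the image of a polynomial in
`ℤ[x, y, z] / (x + y + z) = ℤ[x, y]`. -/
noncomputable def windowMap (s A n : ℕ) : MvPolynomial (Fin 3) ℤ →ₗ[ℤ] (Fin n → ℤ) :=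
  coeffMap (windowVec s A n) ∘ₗ elimZ.toLinearMap

theorem windowMap_apply (s A n : ℕ) (u : MvPolynomial (Fin 3) ℤ) :
    windowMap s A n u = coeffMap (windowVec s A n) (elimZ u) := rfl

theorem windowMap_linForm_mul (s A n : ℕ) (u : MvPolynomial (Fin 3) ℤ) :
    windowMap s A n (linForm * u) = 0 := by
  rw [windowMap_apply, map_mul, elimZ_linForm, zero_mul, map_zero]

theorem windowMap_monomial {s A n : ℕ} (hn : A + n ≤ s + 2) (m : Fin 3 →₀ ℕ) (j : Fin n) :
    windowMap s A n (MvPolynomial.monomial m 1) j =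
      (-1) ^ m 2 * if m 0 + m 1 + m 2 = s + 1 then binom (m 2) ((A : ℤ) + j - m 1) else 0 := by
  have hj := j.isLt
  have h : s + 1 - (A + j) + (A + j) = s + 1 := by omega
  rw [windowMap_apply, coeffMap_apply, windowVec, coeff_elimZ_monomial, h]
  push_cast
  rfl

theorem windowVec_injective (s A n : ℕ) : Function.Injective (windowVec s A n) := by
  intro i j h
  have h1 : A + (i : ℕ) = A + j := DFunLike.congr_fun h 1
  exact Fin.ext (by omega)

theorem windowMap_surjective (s A n : ℕ) : Function.Surjective (windowMap s A n) := by
  intro v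
  refine ⟨∑ i, MvPolynomial.monomial (windowVec s A n i) (v i), ?_⟩
  rw [windowMap_apply, map_sum,
    Finset.sum_congr rfl fun i _ => elimZ_monomial_of_two_eq_zero (m := windowVec s A n i) rfl (v i),
    coeffMap_sum_monomial (windowVec_injective s A n)]

theorem MvPolynomial.map_mem_of_forall_monomial {σ F : Type*} [AddCommGroup F]
    (f : MvPolynomial σ ℤ →ₗ[ℤ] F) (L : Submodule ℤ F) (u : MvPolynomial σ ℤ)
    (h : ∀ m ∈ u.support, f (MvPolynomial.monomial m 1) ∈ L) : f u ∈ L := by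
  rw [u.as_sum, map_sum]
  refine Submodule.sum_mem _ fun m hm => ?_
  rw [← mul_one (u.coeff m), ← smul_eq_mul, ← MvPolynomial.smul_monomial, map_smul]
  exact Submodule.smul_mem _ _ (h m hm)

section

variable {a b c α β γ s A B C M : ℕ}

/-- A row of `matrixN` of the first kind comes from `x^(C-1-i) y^i z^c`. -/
theorem windowMap_monomial_eq_row_of_lt (hn : A + (C + M) ≤ s + 2) (hC : C + c = s + 2)
    (i : Fin (C + M)) (hi : (i : ℕ) < C) :
    windowMap s A (C + M) (MvPolynomial.monomial (expVec (C - 1 - i) i c) 1) =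
      (-1) ^ c • (matrixN c β γ A C M).row i := by
  ext j
  rw [windowMap_monomial hn, Pi.smul_apply, smul_eq_mul, expVec_zero, expVec_one, expVec_two,
    if_pos (by omega)]
  simp only [Matrix.row, matrixN, Matrix.of_apply, if_pos hi]

/-- A row of `matrixN` of the second kind comes from a multiple of `x^α y^β z^γ` whose exponent of
`z` is `γ`. -/
theorem windowMap_monomial_eq_row_of_le (hn : A + (C + M) ≤ s + 2)
    (hM : M + (α + β + γ) = s + 2) (i : Fin (C + M)) (hi : C ≤ (i : ℕ)) :
    windowMap s A (C + M)
        (MvPolynomial.monomial (expVec (α + (C + M - 1 - i)) (β + (i - C)) γ) 1) =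
      (-1) ^ γ • (matrixN c β γ A C M).row i := by
  have hi' := i.isLt
  ext j
  rw [windowMap_monomial hn, Pi.smul_apply, smul_eq_mul, expVec_zero, expVec_one, expVec_two,
    if_pos (by omega)]
  simp only [Matrix.row, matrixN, Matrix.of_apply, if_neg (not_lt.mpr hi)]
  congr 2
  push_cast [Nat.cast_sub hi]
  ring

/-- If every monomial `x^i y^j g` of degree `s + 1` is sent into `L`, so is every monomial multiple
of `g`: modulo `x + y + z` the cofactor of `g` is a polynomial in `x` and `y`. -/
theorem windowMap_monomial_add_mem {n : ℕ} (hn : A + n ≤ s + 2) (L : Submodule ℤ (Fin n → ℤ))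
    (g : Fin 3 →₀ ℕ)
    (h : ∀ m : Fin 3 →₀ ℕ, m 2 = 0 → (m + g) 0 + (m + g) 1 + (m + g) 2 = s + 1 →
      windowMap s A n (MvPolynomial.monomial (m + g) 1) ∈ L) (m : Fin 3 →₀ ℕ) :
    windowMap s A n (MvPolynomial.monomial (m + g) 1) ∈ L := by
  have hmul : ∀ m : Fin 3 →₀ ℕ, (MvPolynomial.monomial (m + g) (1 : ℤ)) =
      MvPolynomial.monomial m 1 * MvPolynomial.monomial g 1 := fun m => by
    rw [MvPolynomial.monomial_mul, one_mul]
  have hred : windowMap s A n (MvPolynomial.monomial (m + g) 1) =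
      (windowMap s A n ∘ₗ LinearMap.mulRight ℤ (MvPolynomial.monomial g 1))
        (elimZ (MvPolynomial.monomial m 1)) := by
    rw [LinearMap.comp_apply, LinearMap.mulRight_apply, hmul, windowMap_apply, windowMap_apply,
      map_mul elimZ, map_mul elimZ, elimZ_elimZ]
  rw [hred]
  refine MvPolynomial.map_mem_of_forall_monomial _ _ _ fun m' hm' => ?_
  rw [LinearMap.comp_apply, LinearMap.mulRight_apply, ← hmul]
  by_cases hd : (m' + g) 0 + (m' + g) 1 + (m' + g) 2 = s + 1
  · exact h m' (eq_zero_of_mem_support_elimZ hm') hd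
  · convert L.zero_mem
    ext j
    rw [windowMap_monomial hn, if_neg hd, mul_zero, Pi.zero_apply]

/-- The monomials that vanish in degree `s + 1` of the quotient by the ideal are sent into the row
lattice of `matrixN`. -/
theorem windowMap_monomial_mem_span_row (hA : A + a = s + 2) (hb : A + (C + M) = b)
    (hn : A + (C + M) ≤ s + 2) (hC : C + c = s + 2) (hM : M + (α + β + γ) = s + 2)
    {m : Fin 3 →₀ ℕ}
    (hm : m 0 + m 1 + m 2 = s + 1 → DominatesGenerator a b c α β γ m) :
    windowMap s A (C + M) (MvPolynomial.monomial m 1) ∈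
      Submodule.span ℤ (Set.range (matrixN c β γ A C M).row) := by
  have hzero : (∀ j : Fin (C + M), m 0 + m 1 + m 2 = s + 1 →
      binom (m 2) ((A : ℤ) + j - m 1) = 0) →
      windowMap s A (C + M) (MvPolynomial.monomial m 1) ∈
        Submodule.span ℤ (Set.range (matrixN c β γ A C M).row) := by
    intro h
    convert Submodule.zero_mem _
    ext j
    rw [windowMap_monomial hn, Pi.zero_apply]
    split_ifs with hd
    · rw [h j hd, mul_zero]
    · rw [mul_zero]
  by_cases hd : m 0 + m 1 + m 2 = s + 1
  · rcases hm hd with ha | hb' | hc | hαβγ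
    · -- The exponents of `x` in the window are less than `a`.
      refine hzero fun j _ => ?_
      have hj := j.isLt
      unfold binom
      split_ifs
      · rw [Nat.choose_eq_zero_of_lt (by omega), Nat.cast_zero]
      · rfl
    · refine hzero fun j _ => if_neg ?_
      have hj := j.isLt
      omega
    · have hg : m = (m - expVec 0 0 c) + expVec 0 0 c := by
        apply exponent_ext <;> simp
        omega
      rw [hg]
      refine windowMap_monomial_add_mem hn _ _ (fun m' h2 hd' => ?_) _
      simp at hd'
      have hm' : m' + expVec 0 0 c = expVec (C - 1 - m' 1) (m' 1) c := by
        apply exponent_ext <;> simp <;> omega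
      rw [hm', windowMap_monomial_eq_row_of_lt (β := β) (γ := γ) hn hC ⟨m' 1, by omega⟩
        (show m' 1 < C by omega)]
      exact Submodule.smul_mem _ _ (Submodule.subset_span ⟨_, rfl⟩)
    · have hg : m = (m - expVec α β γ) + expVec α β γ := by
        apply exponent_ext <;> simp <;> omega
      rw [hg]
      refine windowMap_monomial_add_mem hn _ _ (fun m' h2 hd' => ?_) _
      simp at hd'
      have hi : C + m' 1 < C + M := by omega
      have hm' : m' + expVec α β γ =
          expVec (α + (C + M - 1 - (C + m' 1))) (β + (C + m' 1 - C)) γ := by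
        apply exponent_ext <;> simp <;> omega
      rw [hm', windowMap_monomial_eq_row_of_le (c := c) hn hM ⟨C + m' 1, hi⟩
        (Nat.le_add_right _ _)]
      exact Submodule.smul_mem _ _ (Submodule.subset_span ⟨_, rfl⟩)
  · exact hzero fun j h => absurd h hd

/-- Each row of `matrixN` is the image of a polynomial, namely plus or minus a monomial, that
vanishes in the quotient by the ideal. -/
theorem exists_windowMap_eq_row (hn : A + (C + M) ≤ s + 2) (hC : C + c = s + 2)
    (hM : M + (α + β + γ) = s + 2) (i : Fin (C + M)) :
    ∃ (m : Fin 3 →₀ ℕ) (r : ℤ), DominatesGenerator a b c α β γ m ∧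
      windowMap s A (C + M) (MvPolynomial.monomial m r) = (matrixN c β γ A C M).row i := by
  have hr : ∀ (m : Fin 3 →₀ ℕ) (k : ℕ), windowMap s A (C + M) (MvPolynomial.monomial m 1) =
      (-1) ^ k • (matrixN c β γ A C M).row i →
      windowMap s A (C + M) (MvPolynomial.monomial m ((-1) ^ k)) =
        (matrixN c β γ A C M).row i := fun m k h => by
    rw [← mul_one ((-1 : ℤ) ^ k), ← smul_eq_mul, ← MvPolynomial.smul_monomial, map_smul, h,
      smul_smul, ← mul_pow]
    simp
  rcases lt_or_ge (i : ℕ) C with hi | hi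
  · exact ⟨_, _, Or.inr (Or.inr (Or.inl le_rfl)),
      hr _ _ (windowMap_monomial_eq_row_of_lt hn hC i hi)⟩
  · exact ⟨_, _, Or.inr (Or.inr (Or.inr ⟨Nat.le_add_right _ _, Nat.le_add_right _ _, le_rfl⟩)),
      hr _ _ (windowMap_monomial_eq_row_of_le hn hM i hi)⟩

/-- The zero-one matrix of multiplication by `x + y + z` from degree `s` to degree `s + 1`,
for arbitrary enumerations `r` and `t` of the monomials outside the ideal, has the same determinant
up to sign as `matrixN`. -/
theorem abs_det_divisibility_eq_abs_det_matrixN {ι : Type*} [Fintype ι] [DecidableEq ι]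
    {r t : ι → Fin 3 →₀ ℕ} (ht : Function.Injective t)
    (hr_range : ∀ m, m ∈ Set.range r ↔
      m 0 + m 1 + m 2 = s ∧ ¬ DominatesGenerator a b c α β γ m)
    (ht_range : ∀ m, m ∈ Set.range t ↔
      m 0 + m 1 + m 2 = s + 1 ∧ ¬ DominatesGenerator a b c α β γ m)
    {Z : Matrix ι ι ℤ} (hZ : ∀ i j, Z i j = if r i ≤ t j then 1 else 0)
    (hA : A + a = s + 2) (hb : A + (C + M) = b) (hn : A + (C + M) ≤ s + 2)
    (hC : C + c = s + 2) (hM : M + (α + β + γ) = s + 2) :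
    |Z.det| = |(matrixN c β γ A C M).det| := by
  classical
  have hrow : ∀ i, coeffMap t (linForm * MvPolynomial.monomial (r i) 1) = Z.row i := by
    intro i
    ext j
    have hi := ((hr_range _).mp ⟨i, rfl⟩).1
    have hj := ((ht_range _).mp ⟨j, rfl⟩).1
    rw [coeffMap_apply, coeff_linForm_mul_monomial, Matrix.row, hZ]
    exact if_congr (and_iff_left (by omega)) rfl rfl
  have hmul : ∀ v, coeffMap t (linForm * v) ∈ Submodule.span ℤ (Set.range Z.row) := by
    intro v
    refine MvPolynomial.map_mem_of_forall_monomial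
      (coeffMap t ∘ₗ LinearMap.mulLeft ℤ linForm) _ v fun m _ => ?_
    rw [LinearMap.comp_apply, LinearMap.mulLeft_apply]
    by_cases hm : m ∈ Set.range r
    · obtain ⟨i, rfl⟩ := hm
      rw [hrow]
      exact Submodule.subset_span ⟨i, rfl⟩
    · convert Submodule.zero_mem _
      ext j
      rw [coeffMap_apply, coeff_linForm_mul_monomial, Pi.zero_apply]
      refine if_neg fun ⟨hle, hd⟩ => ?_
      have hj := (ht_range _).mp ⟨j, rfl⟩
      exact hm ((hr_range m).mpr ⟨by omega, fun h => hj.2 (h.mono hle)⟩)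
  refine Matrix.abs_det_eq_of_comap_span_row_eq (p := coeffMap t) (q := windowMap s A (C + M))
    (fun v => ⟨_, coeffMap_sum_monomial ht v⟩) (windowMap_surjective s A (C + M)) ?_
  -- A polynomial without coefficients at the basis monomials is sent into the row lattice.
  have hker : ∀ u, coeffMap t u = 0 → windowMap s A (C + M) u ∈
      Submodule.span ℤ (Set.range (matrixN c β γ A C M).row) := by
    intro u hu
    refine MvPolynomial.map_mem_of_forall_monomial _ _ u fun m hm => ?_
    refine windowMap_monomial_mem_span_row hA hb hn hC hM fun hd => ?_
    by_contra hdom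
    obtain ⟨j, rfl⟩ := (ht_range m).mpr ⟨hd, hdom⟩
    exact MvPolynomial.mem_support_iff.mp hm (congrFun hu j)
  -- Conversely, modulo `x + y + z` a polynomial that vanishes in the window has no coefficient at
  -- a basis monomial, because those free of `z` lie in the window.
  have hker' : ∀ u, windowMap s A (C + M) u = 0 →
      coeffMap t u ∈ Submodule.span ℤ (Set.range Z.row) := by
    intro u hu
    obtain ⟨v, hv⟩ := exists_sub_elimZ_eq u
    have h0 : coeffMap t (elimZ u) = 0 := by
      ext j
      rw [coeffMap_apply, Pi.zero_apply]
      by_contra hne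
      have h2 := eq_zero_of_mem_support_elimZ (MvPolynomial.mem_support_iff.mpr hne)
      obtain ⟨hd, hdom⟩ := (ht_range _).mp ⟨j, rfl⟩
      unfold DominatesGenerator at hdom
      have hlt : t j 1 - A < C + M := by omega
      have htj : t j = windowVec s A (C + M) ⟨t j 1 - A, hlt⟩ := by
        apply exponent_ext <;> simp [windowVec] <;> omega
      rw [htj] at hne
      exact hne (congrFun hu ⟨t j 1 - A, hlt⟩)
    rw [← sub_zero (coeffMap t u), ← h0, ← map_sub, hv]
    exact hmul v
  apply le_antisymm
  · intro u hu
    rw [Submodule.mem_comap] at hu ⊢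
    obtain ⟨v, hv⟩ : ∃ v, coeffMap t (linForm * v) = coeffMap t u := by
      have hle : Submodule.span ℤ (Set.range Z.row) ≤
          LinearMap.range (coeffMap t ∘ₗ LinearMap.mulLeft ℤ linForm) := by
        rw [Submodule.span_le]
        rintro _ ⟨i, rfl⟩
        exact ⟨_, hrow i⟩
      exact hle hu
    have h := hker (u - linForm * v) (by rw [map_sub, hv, sub_self])
    rwa [map_sub, windowMap_linForm_mul, sub_zero] at h
  · intro u hu
    rw [Submodule.mem_comap] at hu ⊢
    obtain ⟨w, hw0, hw⟩ : ∃ w, coeffMap t w = 0 ∧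
        windowMap s A (C + M) w = windowMap s A (C + M) u := by
      have hle : Submodule.span ℤ (Set.range (matrixN c β γ A C M).row) ≤
          (LinearMap.ker (coeffMap t)).map (windowMap s A (C + M)) := by
        rw [Submodule.span_le]
        rintro _ ⟨i, rfl⟩
        obtain ⟨m, k, hdom, hm⟩ := exists_windowMap_eq_row (a := a) (b := b) hn hC hM i
        refine ⟨_, ?_, hm⟩
        rw [SetLike.mem_coe, LinearMap.mem_ker]
        ext j
        rw [coeffMap_apply, MvPolynomial.coeff_monomial, Pi.zero_apply]
        exact if_neg fun (h : m = t j) => ((ht_range _).mp ⟨j, rfl⟩).2 (h ▸ hdom)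
      exact hle hu
    have h := hker' (u - w) (by rw [map_sub, hw, sub_self])
    rwa [map_sub, hw0, sub_zero] at h

end

theorem mainTheorem4 (K : Type*) [Field K] (a b c α β γ s A B C M : ℕ)
    -- the exponents
    (hα : α < a) (hβ : β < b) (hγ : γ < c)
    -- at most one of `α`, `β`, `γ` is zero
    (hαβ : ¬(α = 0 ∧ β = 0)) (hαγ : ¬(α = 0 ∧ γ = 0)) (hβγ : ¬(β = 0 ∧ γ = 0))
    -- `s = (a + b + c + α + β + γ) / 3 - 2` is an integer
    (hs : a + b + c + α + β + γ = 3 * (s + 2))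
    -- `A = s + 2 - a`, `B = s + 2 - b`, `C = s + 2 - c`, `M = s + 2 - (α + β + γ)` are nonnegative
    (hA : A + a = s + 2) (hB : B + b = s + 2) (hC : C + c = s + 2)
    (hM : M + (α + β + γ) = s + 2)
    (hA' : A ≤ β + γ) (hB' : B ≤ α + γ) (hC' : C ≤ α + β) :
    -- `Z` is a square matrix, and its determinant agrees with that of `N` up to sign
    ∃ h : hVec (monomialACI K a b c α β γ) s = hVec (monomialACI K a b c α β γ) (s + 1),
      |((matrixZ (monomialACI K a b c α β γ) s).submatrix id (Fin.cast h)).det| =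
        |(matrixN c β γ A C M).det| := by
  have h := hVec_eq_hVec_succ (K := K) hs hA hB hC hM hA' hB' hC'
  have hrange : Set.range (basisMonomial (monomialACI K a b c α β γ) (s + 1) ∘ Fin.cast h) =
      Set.range (basisMonomial (monomialACI K a b c α β γ) (s + 1)) :=
    (finCongr h).surjective.range_comp _
  refine ⟨h, abs_det_divisibility_eq_abs_det_matrixN
    ((basisMonomial_injective _ _).comp (Fin.cast_injective h))
    (fun _ => mem_range_basisMonomial_iff) (fun _ => ?_) (fun i j => ?_)
    hA (by omega) (by omega) hC hM⟩
  · rw [hrange]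
    exact mem_range_basisMonomial_iff
  · rw [Matrix.submatrix_apply, matrixZ, Matrix.of_apply]
    rfl
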